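/- Let $\phi:\mathbb{R}\to\mathbb{R}$ be the scaling function of a multiresolution analysis of $L^2(\mathbb{R})$: its integer translates are orthonormal, the closed linear spans $V_j$ of $\{\phi(2^j\cdot-k):k\in\mathbb{Z}\}$ satisfy $V_j\subset V_{j+1}$ for all $j\in\mathbb{Z}$, and $\bigcup_j V_j$ is dense in $L^2(\mathbb{R})$. Let $r\in\mathbb{N}$ and $0<t<r-1$, and suppose that $\phi$ is $(r-1)$-regular: for $0\le a\le r-1$ the weak derivative $D^a\phi$ exists and $|D^a\phi(x)|\le c_1\lambda^{c_2|x|}$ for almost every $x\in\mathbb{R}$, for some $c_1,c_2>0$ and $0<\lambda<1$. Let $$\psi(x)=\sqrt2\sum_{k\in\mathbb{Z}}(-1)^{k+1}h_{1-k}\,\phi(2x-k),\qquad h_k=\int_{\mathbb{R}}\phi(x)\sqrt2\,\phi(2x-k)\,dx,$$ be the associated mother wavelet, and put $\psi_{lk}(x)=2^{l/2}\psi(2^lx-k)$, $\alpha_k(f)=\int\phi(x-k)f(x)\,dx$ and $\beta_{lk}(f)=\int\psi_{lk}(x)f(x)\,dx$ for $k\in\mathbb{Z}$ and integers $l\ge0$.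 Let $\mathcal{C}^t(\mathbb{R})$ be the H\"older–Zygmund space of bounded continuous $f:\mathbb{R}\to\mathbb{R}$ with $$\|f\|_{t,\infty}=\sup_{k\in\mathbb{Z}}|\alpha_k(f)|+\sup_{l\ge0}\sup_{k\in\mathbb{Z}}\bigl|2^{l(t+1/2)}\beta_{lk}(f)\bigr|<\infty .$$ Put $K(x,y)=\sum_{k\in\mathbb{Z}}\phi(x-k)\phi(y-k)$ and $K_j(f)(y)=\int_{\mathbb{R}}2^jK(2^jy,2^jx)f(x)\,dx$ for integers $j\ge0$, and let $\|g\|_\infty=\sup_{x\in\mathbb{R}}|g(x)|$. Then the set $$\mathcal{N}_t=\{f\in\mathcal{C}^t(\mathbb{R}):\text{there do not exist }b_1>0\text{ and }j_0\in\mathbb{N}\text{ such that }\|K_j(f)-f\|_\infty\ge b_12^{-jt}\text{ for all }j\ge j_0\}$$ is nowhere dense in $\mathcal{C}^t(\mathbb{R})$ with the topology of the norm $\|\cdot\|_{t,\infty}$, that is, its closure has empty interior. -/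

import Mathlib

open MeasureTheory
open scoped ContDiff BoundedContinuousFunction ENNReal

noncomputable section

namespace Wavelet

/-- The space `V_j ⊆ L²(ℝ)`: the closed linear span of the functions `x ↦ φ (2^j x - k)`, `k ∈ ℤ`. -/
def approxSpace (φ : ℝ → ℝ) (j : ℤ) : Submodule ℝ (Lp ℝ 2 (volume : Measure ℝ)) :=
  (Submodule.span ℝ
    {g : Lp ℝ 2 (volume : Measure ℝ) | ∃ k : ℤ, g =ᵐ[volume] fun x => φ ((2 : ℝ) ^ j * x - k)}).topologicalClosure

/-- `φ` is the scaling function (father wavelet) of a multiresolution analysis of `L²(ℝ)`: its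
integer translates are orthonormal, the spaces `V_j` increase, and their union is dense.
(That the `V_j` intersect in `0` follows.) -/
structure IsScalingFunction (φ : ℝ → ℝ) : Prop where
  memLp : MemLp φ 2 volume
  orthonormal : ∀ k l : ℤ, ∫ x, φ (x - k) * φ (x - l) = if k = l then 1 else 0
  nested : ∀ j : ℤ, approxSpace φ j ≤ approxSpace φ (j + 1)
  dense : Dense (⋃ j : ℤ, (approxSpace φ j : Set (Lp ℝ 2 (volume : Measure ℝ))))

/-- `h` is the weak (distributional) derivative of order `a` of `g`. -/
structure IsWeakDeriv (a : ℕ) (g h : ℝ → ℝ) : Prop where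
  locallyIntegrable : LocallyIntegrable g volume
  locallyIntegrable_deriv : LocallyIntegrable h volume
  integral_eq : ∀ η : ℝ → ℝ, ContDiff ℝ ∞ η → HasCompactSupport η →
    ∫ x, iteratedDeriv a η x * g x = (-1) ^ a * ∫ x, η x * h x

/-- `φ` is `s`-regular: the weak derivatives `D^a φ` of orders `0 ≤ a ≤ s` exist and satisfy
`|D^a φ(x)| ≤ c₁ λ^{c₂|x|}` for almost every `x`. -/
def IsRegular (s : ℕ) (φ : ℝ → ℝ) : Prop :=
  ∃ c₁ c₂ lam : ℝ, 0 < c₁ ∧ 0 < c₂ ∧ 0 < lam ∧ lam < 1 ∧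
    ∀ a ≤ s, ∃ h : ℝ → ℝ, IsWeakDeriv a φ h ∧ ∀ᵐ x, |h x| ≤ c₁ * lam ^ (c₂ * |x|)

/-- An `s`-regular scaling function. -/
structure RegularScalingFunction (s : ℕ) where
  toFun : ℝ → ℝ
  isScalingFunction : IsScalingFunction toFun
  isRegular : IsRegular s toFun

/-- The filter coefficients `h_k = ⟨φ, √2 φ(2 · - k)⟩` of the refinement equation. -/
def filterCoeff (φ : ℝ → ℝ) (k : ℤ) : ℝ :=
  ∫ x, φ x * (√2 * φ (2 * x - k))

/-- The mother wavelet associated with `φ`: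
`ψ(x) = √2 ∑_k (-1)^(k+1) h_{1-k} φ(2x - k)`. -/
def mother (φ : ℝ → ℝ) (x : ℝ) : ℝ :=
  √2 * ∑' k : ℤ, (-1) ^ (k + 1) * filterCoeff φ (1 - k) * φ (2 * x - k)

/-- The wavelets `ψ_{lk}(x) = 2^{l/2} ψ(2^l x - k)`. -/
def waveletFun (φ : ℝ → ℝ) (l : ℕ) (k : ℤ) (x : ℝ) : ℝ :=
  (2 : ℝ) ^ ((l : ℝ) / 2) * mother φ ((2 : ℝ) ^ l * x - k)

/-- The coefficients `α_k(f) = ∫ φ(x - k) f(x) dx`. -/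
def alpha (φ : ℝ → ℝ) (k : ℤ) (f : ℝ → ℝ) : ℝ :=
  ∫ x, φ (x - k) * f x

/-- The coefficients `β_{lk}(f) = ∫ ψ_{lk}(x) f(x) dx`. -/
def beta (φ : ℝ → ℝ) (l : ℕ) (k : ℤ) (f : ℝ → ℝ) : ℝ :=
  ∫ x, waveletFun φ l k x * f x

/-- `‖f‖_{t,∞} = sup_k |α_k(f)| + sup_{l ≥ 0} sup_k |2^{l(t+1/2)} β_{lk}(f)|`, in `[0, ∞]`. -/
def eHolderNorm (φ : ℝ → ℝ) (t : ℝ) (f : ℝ → ℝ) : ℝ≥0∞ :=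
  (⨆ k : ℤ, ‖alpha φ k f‖ₑ) +
    ⨆ (l : ℕ) (k : ℤ), ‖(2 : ℝ) ^ ((l : ℝ) * (t + 1 / 2)) * beta φ l k f‖ₑ

/-- The projection kernel `K(x, y) = ∑_k φ(x - k) φ(y - k)`. -/
def kernel (φ : ℝ → ℝ) (x y : ℝ) : ℝ :=
  ∑' k : ℤ, φ (x - k) * φ (y - k)

/-- `K_j(f)(y) = ∫ 2^j K(2^j y, 2^j x) f(x) dx`. -/
def proj (φ : ℝ → ℝ) (j : ℕ) (f : ℝ → ℝ) (y : ℝ) : ℝ :=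
  ∫ x, (2 : ℝ) ^ j * kernel φ ((2 : ℝ) ^ j * y) ((2 : ℝ) ^ j * x) * f x

/-- The supremum norm `‖g‖_∞ = sup_x |g(x)|`, in `[0, ∞]`. -/
def eSupNorm (g : ℝ → ℝ) : ℝ≥0∞ := ⨆ x : ℝ, ‖g x‖ₑ

/-! Helper facts: `φ` and `ψ` are integrable, so that the coefficients of bounded continuous
functions are well defined and linear. -/

theorem integrable_exp_neg_mul_abs {b : ℝ} (hb : 0 < b) :
    Integrable (fun x : ℝ => Real.exp (-b * |x|)) := by
  have h1 : IntegrableOn (fun x : ℝ => Real.exp (-b * |x|)) (Set.Ioi 0) :=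
    (exp_neg_integrableOn_Ioi 0 hb).congr_fun
      (fun x hx => by simp only [abs_of_pos (Set.mem_Ioi.1 hx)]) measurableSet_Ioi
  have h2 : IntegrableOn (fun x : ℝ => Real.exp (-b * |x|)) (Set.Iic 0) := by
    have h3 : Integrable (fun x : ℝ => Real.exp (b * x)) (volume.restrict (Set.Iic 0)) :=
      integrableOn_exp_mul_Iic hb 0
    refine IntegrableOn.congr_fun h3 (fun x hx => ?_) measurableSet_Iic
    simp only [abs_of_nonpos (Set.mem_Iic.1 hx)]
    congr 1; ring
  have := h2.union h1
  rwa [Set.Iic_union_Ioi, integrableOn_univ] at this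

theorem summable_exp_neg_mul_abs {b : ℝ} (hb : 0 < b) :
    Summable (fun k : ℤ => Real.exp (-b * |(k : ℝ)|)) := by
  have h : Summable (fun n : ℕ => Real.exp (-b * n)) := by
    simpa [mul_comm] using Real.summable_exp_nat_mul_iff.2 (neg_lt_zero.2 hb)
  refine Summable.of_nat_of_neg ?_ ?_ <;> simpa using h

namespace RegularScalingFunction

variable {s : ℕ} (Φ : RegularScalingFunction s)

theorem exists_bound : ∃ C b : ℝ, 0 < C ∧ 0 < b ∧
    ∀ᵐ x, |Φ.toFun x| ≤ C * Real.exp (-b * |x|) := by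
  obtain ⟨c₁, c₂, lam, h1, h2, h3, h4, H⟩ := Φ.isRegular
  obtain ⟨h, hw, hb⟩ := H 0 (Nat.zero_le _)
  have heq : ∀ᵐ x, Φ.toFun x = h x := by
    refine ae_eq_of_integral_contDiff_smul_eq hw.locallyIntegrable hw.locallyIntegrable_deriv ?_
    intro η hη hc
    simpa using hw.integral_eq η hη hc
  refine ⟨c₁, -(c₂ * Real.log lam), h1, ?_, ?_⟩
  · have := Real.log_neg h3 h4
    nlinarith
  · filter_upwards [heq, hb] with x hx hx'
    rw [hx]
    refine hx'.trans (le_of_eq ?_)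
    rw [Real.rpow_def_of_pos h3]
    congr 2; ring

theorem integrable : Integrable Φ.toFun := by
  obtain ⟨C, b, _, hb, h⟩ := Φ.exists_bound
  refine ((integrable_exp_neg_mul_abs hb).const_mul C).mono'
    Φ.isScalingFunction.memLp.aestronglyMeasurable ?_
  simpa only [Real.norm_eq_abs] using h

theorem integrable_comp (a c : ℝ) (ha : a ≠ 0) : Integrable (fun x => Φ.toFun (a * x - c)) :=
  (Φ.integrable.comp_sub_right c).comp_mul_left' ha

theorem summable_filterCoeff : Summable (filterCoeff Φ.toFun) := by
  obtain ⟨C, b, hC, hb, h⟩ := Φ.exists_bound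
  have key : ∀ k : ℤ, ‖filterCoeff Φ.toFun k‖ ≤
      (√2 * C * C * ∫ x : ℝ, Real.exp (-(b / 2) * |x|)) * Real.exp (-(b / 4) * |(k : ℝ)|) := by
    intro k
    have h2 : ∀ᵐ x : ℝ, |Φ.toFun (2 * x - k)| ≤ C * Real.exp (-b * |2 * x - k|) := by
      have hm : Measure.QuasiMeasurePreserving (fun x : ℝ => 2 * x) volume volume := by
        refine ⟨measurable_const_mul 2, ?_⟩
        rw [Real.map_volume_mul_left two_ne_zero]
        exact Measure.smul_absolutelyContinuous
      exact ((measurePreserving_sub_right volume (k : ℝ)).quasiMeasurePreserving.comp hm).ae h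
    have hle : ‖filterCoeff Φ.toFun k‖ ≤ ∫ x : ℝ,
        (√2 * C * C * Real.exp (-(b / 4) * |(k : ℝ)|)) * Real.exp (-(b / 2) * |x|) := by
      refine norm_integral_le_of_norm_le
        ((integrable_exp_neg_mul_abs (half_pos hb)).const_mul _) ?_
      filter_upwards [h, h2] with x hx hx'
      have he : Real.exp (-b * |x|) * Real.exp (-b * |2 * x - k|) ≤
          Real.exp (-(b / 4) * |(k : ℝ)|) * Real.exp (-(b / 2) * |x|) := by
        rw [← Real.exp_add, ← Real.exp_add]
        refine Real.exp_le_exp.2 ?_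
        have h3 : |(k : ℝ)| ≤ 2 * |x| + |2 * x - k| := by
          have h4 := abs_sub (2 * x) (2 * x - (k : ℝ))
          rw [abs_mul, abs_two] at h4
          simpa using h4
        nlinarith [abs_nonneg (2 * x - (k : ℝ))]
      rw [norm_mul, norm_mul, Real.norm_eq_abs, Real.norm_eq_abs, Real.norm_eq_abs,
        abs_of_nonneg (Real.sqrt_nonneg 2)]
      calc |Φ.toFun x| * (√2 * |Φ.toFun (2 * x - k)|)
          ≤ (C * Real.exp (-b * |x|)) * (√2 * (C * Real.exp (-b * |2 * x - k|))) := by gcongr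
        _ = √2 * C * C * (Real.exp (-b * |x|) * Real.exp (-b * |2 * x - k|)) := by ring
        _ ≤ √2 * C * C *
              (Real.exp (-(b / 4) * |(k : ℝ)|) * Real.exp (-(b / 2) * |x|)) := by gcongr
        _ = _ := by ring
    refine hle.trans (le_of_eq ?_)
    rw [integral_const_mul]; ring
  exact Summable.of_norm_bounded
    ((summable_exp_neg_mul_abs (by positivity : 0 < b / 4)).mul_left _) key

theorem integrable_mother : Integrable (mother Φ.toFun) := by
  set F : ℤ → ℝ → ℝ := fun k x =>
    (-1) ^ (k + 1) * filterCoeff Φ.toFun (1 - k) * Φ.toFun (2 * x - k) with hF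
  have hint : ∀ k, Integrable (F k) := fun k =>
    (Φ.integrable_comp 2 k two_ne_zero).const_mul _
  have hval : ∀ k, ∫ x, ‖F k x‖ =
      ‖filterCoeff Φ.toFun (1 - k)‖ * ∫ x, ‖Φ.toFun (2 * x)‖ := by
    intro k
    have h1 : ∀ x, ‖F k x‖ = ‖filterCoeff Φ.toFun (1 - k)‖ * ‖Φ.toFun (2 * (x - k / 2))‖ := by
      intro x
      have : 2 * (x - (k : ℝ) / 2) = 2 * x - k := by ring
      simp [hF, this, norm_mul, norm_zpow]
    simp_rw [h1]
    rw [integral_const_mul, integral_sub_right_eq_self (fun x => ‖Φ.toFun (2 * x)‖)]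
  have hsum : Summable fun k => ∫ x, ‖F k x‖ := by
    simp_rw [hval]
    refine Summable.mul_right _ ?_
    exact (Equiv.subLeft (1 : ℤ)).summable_iff.2 Φ.summable_filterCoeff.norm
  have hlin : ∫⁻ x, ∑' k, ‖F k x‖ₑ ≠ ⊤ := by
    rw [lintegral_tsum (fun k => (hint k).aestronglyMeasurable.enorm)]
    have : ∀ k, ∫⁻ x, ‖F k x‖ₑ = ENNReal.ofReal (∫ x, ‖F k x‖) := fun k =>
      (ofReal_integral_norm_eq_lintegral_enorm (hint k)).symm
    simp_rw [this]
    exact hsum.tsum_ofReal_ne_top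
  have hmeas : AEMeasurable (fun x => ∑' k, ‖F k x‖ₑ) volume :=
    AEMeasurable.tsum fun k => (hint k).aestronglyMeasurable.enorm
  have hae : ∀ᵐ x, Summable fun k => F k x := by
    filter_upwards [ae_lt_top' hmeas hlin] with x hx
    refine Summable.of_norm ?_
    have := ENNReal.summable_toReal hx.ne
    simpa using this
  have hts : Integrable (fun x => ∑' k, F k x) := by
    refine ⟨?_, ?_⟩
    · refine aestronglyMeasurable_of_tendsto_ae Filter.atTop
        (f := fun (S : Finset ℤ) x => ∑ k ∈ S, F k x) (fun S => ?_) ?_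
      · exact Finset.aestronglyMeasurable_fun_sum S fun k _ => (hint k).aestronglyMeasurable
      · filter_upwards [hae] with x hx
        exact hx.hasSum
    · exact (lintegral_mono fun x => enorm_tsum_le_tsum_enorm).trans_lt hlin.lt_top
  exact hts.const_mul (√2)

theorem integrable_waveletFun (l : ℕ) (k : ℤ) : Integrable (waveletFun Φ.toFun l k) :=
  ((Φ.integrable_mother.comp_sub_right (k : ℝ)).comp_mul_left'
    (pow_ne_zero l (two_ne_zero : (2 : ℝ) ≠ 0))).const_mul _

end RegularScalingFunction

theorem integrable_mul_bcf {g : ℝ → ℝ} (hg : Integrable g) (f : ℝ →ᵇ ℝ) :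
    Integrable (fun x => g x * f x) :=
  hg.mul_bdd f.continuous.aestronglyMeasurable
    (Filter.Eventually.of_forall fun x => f.norm_coe_le_norm x)

section Linearity

variable {s : ℕ} (Φ : RegularScalingFunction s)

theorem alpha_add (k : ℤ) (f g : ℝ →ᵇ ℝ) :
    alpha Φ.toFun k (f + g : ℝ →ᵇ ℝ) = alpha Φ.toFun k f + alpha Φ.toFun k g := by
  have h := Φ.integrable.comp_sub_right (k : ℝ)
  simp only [alpha, BoundedContinuousFunction.coe_add, Pi.add_apply, mul_add]
  exact integral_add (integrable_mul_bcf h f) (integrable_mul_bcf h g)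

theorem beta_add (l : ℕ) (k : ℤ) (f g : ℝ →ᵇ ℝ) :
    beta Φ.toFun l k (f + g : ℝ →ᵇ ℝ) = beta Φ.toFun l k f + beta Φ.toFun l k g := by
  have h := Φ.integrable_waveletFun l k
  simp only [beta, BoundedContinuousFunction.coe_add, Pi.add_apply, mul_add]
  exact integral_add (integrable_mul_bcf h f) (integrable_mul_bcf h g)

theorem alpha_smul (φ : ℝ → ℝ) (k : ℤ) (c : ℝ) (f : ℝ →ᵇ ℝ) :
    alpha φ k (c • f : ℝ →ᵇ ℝ) = c * alpha φ k f := by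
  simp only [alpha, BoundedContinuousFunction.coe_smul, smul_eq_mul, ← integral_const_mul]
  congr 1; ext x; ring

theorem beta_smul (φ : ℝ → ℝ) (l : ℕ) (k : ℤ) (c : ℝ) (f : ℝ →ᵇ ℝ) :
    beta φ l k (c • f : ℝ →ᵇ ℝ) = c * beta φ l k f := by
  simp only [beta, BoundedContinuousFunction.coe_smul, smul_eq_mul, ← integral_const_mul]
  congr 1; ext x; ring

theorem eHolderNorm_add_le (t : ℝ) (f g : ℝ →ᵇ ℝ) :
    eHolderNorm Φ.toFun t (f + g : ℝ →ᵇ ℝ) ≤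
      eHolderNorm Φ.toFun t f + eHolderNorm Φ.toFun t g := by
  unfold eHolderNorm
  rw [add_add_add_comm]
  refine add_le_add (iSup_le fun k => ?_) (iSup₂_le fun l k => ?_)
  · rw [alpha_add]
    refine (enorm_add_le _ _).trans (add_le_add ?_ ?_)
    · exact le_iSup (fun k => ‖alpha Φ.toFun k f‖ₑ) k
    · exact le_iSup (fun k => ‖alpha Φ.toFun k g‖ₑ) k
  · rw [beta_add, mul_add]
    refine (enorm_add_le _ _).trans (add_le_add ?_ ?_)
    · exact le_iSup₂ (f := fun (l : ℕ) (k : ℤ) =>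
        ‖(2 : ℝ) ^ ((l : ℝ) * (t + 1 / 2)) * beta Φ.toFun l k f‖ₑ) l k
    · exact le_iSup₂ (f := fun (l : ℕ) (k : ℤ) =>
        ‖(2 : ℝ) ^ ((l : ℝ) * (t + 1 / 2)) * beta Φ.toFun l k g‖ₑ) l k

theorem eHolderNorm_smul (φ : ℝ → ℝ) (t c : ℝ) (f : ℝ →ᵇ ℝ) :
    eHolderNorm φ t (c • f : ℝ →ᵇ ℝ) = ‖c‖ₑ * eHolderNorm φ t f := by
  unfold eHolderNorm
  simp_rw [alpha_smul, beta_smul, mul_left_comm _ c, enorm_mul, mul_add, ENNReal.mul_iSup]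

theorem eHolderNorm_zero (φ : ℝ → ℝ) (t : ℝ) : eHolderNorm φ t (0 : ℝ →ᵇ ℝ) = 0 := by
  simpa using eHolderNorm_smul φ t 0 0

end Linearity

/-- The bounded continuous functions with `‖f‖_{t,∞} < ∞`, as a linear subspace. -/
def holderZygmundSubmodule {s : ℕ} (Φ : RegularScalingFunction s) (t : ℝ) :
    Submodule ℝ (ℝ →ᵇ ℝ) where
  carrier := {f | eHolderNorm Φ.toFun t f < ⊤}
  add_mem' {f g} hf hg :=
    (eHolderNorm_add_le Φ t f g).trans_lt (ENNReal.add_lt_top.2 ⟨hf, hg⟩)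
  zero_mem' := by
    change eHolderNorm Φ.toFun t (0 : ℝ →ᵇ ℝ) < ⊤
    rw [eHolderNorm_zero]
    exact ENNReal.zero_lt_top
  smul_mem' c f hf := by
    simp only [Set.mem_ofPred_eq, eHolderNorm_smul]
    exact ENNReal.mul_lt_top enorm_lt_top hf

/-- The Hölder–Zygmund space `𝒞^t(ℝ)`, for `0 < t < s`: the bounded continuous functions with
`‖f‖_{t,∞} < ∞`. It carries the topology of `‖·‖_{t,∞}`, not that of the supremum norm. -/
def HolderZygmund {s : ℕ} (Φ : RegularScalingFunction s) (t : ℝ) : Type :=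
  holderZygmundSubmodule Φ t

namespace HolderZygmund

variable {s : ℕ} (Φ : RegularScalingFunction s) (t : ℝ)

instance : AddCommGroup (HolderZygmund Φ t) :=
  inferInstanceAs (AddCommGroup (holderZygmundSubmodule Φ t))

instance : Module ℝ (HolderZygmund Φ t) :=
  inferInstanceAs (Module ℝ (holderZygmundSubmodule Φ t))

variable {Φ t}

/-- The underlying bounded continuous function. -/
def toBCF (f : HolderZygmund Φ t) : ℝ →ᵇ ℝ := Subtype.val f

variable (Φ t)

/-- `‖·‖_{t,∞}` as a seminorm on `𝒞^t(ℝ)`. -/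
def holderSeminorm : AddGroupSeminorm (HolderZygmund Φ t) where
  toFun f := (eHolderNorm Φ.toFun t f.toBCF).toReal
  map_zero' := by
    have : (0 : HolderZygmund Φ t).toBCF = 0 := rfl
    rw [this, eHolderNorm_zero, ENNReal.toReal_zero]
  add_le' f g := by
    have hf : eHolderNorm Φ.toFun t f.toBCF ≠ ⊤ := ne_of_lt f.2
    have hg : eHolderNorm Φ.toFun t g.toBCF ≠ ⊤ := ne_of_lt g.2
    rw [← ENNReal.toReal_add hf hg]
    exact ENNReal.toReal_mono (ENNReal.add_ne_top.2 ⟨hf, hg⟩) (eHolderNorm_add_le Φ t _ _)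
  neg' f := by
    have : (-f).toBCF = (-1 : ℝ) • f.toBCF := (neg_one_smul ℝ f.toBCF).symm
    rw [this, eHolderNorm_smul]
    simp

/-- `‖·‖_{t,∞}` makes `𝒞^t(ℝ)` a (semi)normed group; the metric and the
topology are the ones it induces. -/
instance : SeminormedAddCommGroup (HolderZygmund Φ t) :=
  (holderSeminorm Φ t).toSeminormedAddCommGroup

theorem norm_def (f : HolderZygmund Φ t) :
    ‖f‖ = (eHolderNorm Φ.toFun t f.toBCF).toReal := rfl

end HolderZygmund

/-- `𝒩_t`: the `f ∈ 𝒞^t(ℝ)` for which there are no `b₁ > 0` and `j₀ ∈ ℕ` such that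
`‖K_j(f) - f‖_∞ ≥ b₁ 2^{-jt}` for all `j ≥ j₀`. -/
def exceptionalSet {s : ℕ} (Φ : RegularScalingFunction s) (t : ℝ) : Set (HolderZygmund Φ t) :=
  {f | ¬ ∃ b₁ : ℝ, 0 < b₁ ∧ ∃ j₀ : ℕ, ∀ j : ℕ, j₀ ≤ j →
    ENNReal.ofReal (b₁ * (2 : ℝ) ^ (-((j : ℝ) * t))) ≤
      eSupNorm (fun y => proj Φ.toFun j f.toBCF y - f.toBCF y)}

end Wavelet

end

/-! ### A continuous, exponentially decaying representative of the scaling function -/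

noncomputable section

namespace Wavelet

open Filter Topology

/-! The wavelet `ψ_{jn}` is orthogonal to `V_j`, hence to `K_j f`, so `β_{jn}(f) = ∫ ψ_{jn} (f - K_j
f)`. Since `‖ψ_{jn}‖₁ = 2^{-j/2} ‖ψ‖₁`, this gives `2^{j/2} |β_{jn}(f)| ≤ ‖ψ‖₁ ‖K_j f - f‖_∞`
(`abs_beta_le_eSupNorm`). If at every scale some normalised coefficient `2^{j(t+1/2)} |β_{jk}(f)|`
is at least `ε > 0`, then `‖K_j f - f‖_∞` is at least a constant times `2^{-jt}`, so `f` is not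
exceptional.

Such `f` form `largeCoeffSet`. It is open because the norm controls all normalised coefficients at
once. It is dense because a small series `∑ c_l ψ_{l0}` can be added that lifts the coefficient at
`k = 0` on exactly those scales where it is too small; orthonormality of the wavelets prevents
interference between scales. The exceptional set thus lies in the closed complement of an open dense
set.

The orthogonality relations are identities for the filter `h_k`. As `φ` is given only up to null
sets, a continuous representative is used to build the perturbation; integrals do not see the
change. -/

open scoped Convolution in
-- The derivative falls on `η`, and `s ↦ η (x - s)` is itself a test function, so the definition of
-- the weak derivative transfers it to `g`; the two minus signs cancel.
theorem IsWeakDeriv.hasDerivAt_convolution {g h η : ℝ → ℝ} (hw : IsWeakDeriv 1 g h)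
    (hη : ContDiff ℝ ∞ η) (hc : HasCompactSupport η) (x : ℝ) :
    HasDerivAt (η ⋆[ContinuousLinearMap.lsmul ℝ ℝ, volume] g) (∫ s, η (x - s) * h s) x := by
  have h1 := hc.hasDerivAt_convolution_left (ContinuousLinearMap.lsmul ℝ ℝ)
    (hη.of_le (by exact_mod_cast le_top)) hw.locallyIntegrable x
  refine h1.congr_deriv ?_
  rw [convolution_eq_swap]
  have hcd : ContDiff ℝ ∞ (fun s => η (x - s)) := hη.comp (contDiff_const.sub contDiff_id)
  have hcs : HasCompactSupport (fun s => η (x - s)) :=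
    hc.comp_homeomorph (Homeomorph.subLeft x)
  have h2 := hw.integral_eq _ hcd hcs
  have h3 : ∀ s, iteratedDeriv 1 (fun s => η (x - s)) s = -deriv η (x - s) := by
    intro s
    rw [iteratedDeriv_one]
    exact deriv_comp_const_sub _ _ _
  simp only [h3, neg_mul, integral_neg, pow_one, one_mul] at h2
  simpa using neg_injective h2

/-- A function with an essentially bounded weak derivative is a.e. equal to a Lipschitz function. -/
theorem IsWeakDeriv.exists_lipschitzWith {g h : ℝ → ℝ} {M : NNReal} (hw : IsWeakDeriv 1 g h)
    (hM : ∀ᵐ x, |h x| ≤ M) : ∃ p : ℝ → ℝ, LipschitzWith M p ∧ g =ᵐ[volume] p := by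
  -- Mollifiers with shrinking support and outer-to-inner radius ratio fixed at 2, as the a.e.
  -- convergence theorem requires.
  let B : ℕ → ContDiffBump (0 : ℝ) := fun n =>
    ⟨1 / ((n : ℝ) + 1), 2 / ((n : ℝ) + 1), by positivity, by gcongr; norm_num⟩
  have hB : Tendsto (fun n => (B n).rOut) atTop (𝓝 0) := by
    have := (tendsto_one_div_add_atTop_nhds_zero_nat (𝕜 := ℝ)).const_mul 2
    simpa [B, div_eq_mul_inv] using this
  have hconv := ContDiffBump.ae_convolution_tendsto_right_of_locallyIntegrable (K := 2) hB
    (Eventually.of_forall fun n => le_of_eq (by simp only [B]; ring)) hw.locallyIntegrable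
  have hlip : ∀ n, LipschitzWith M
      (convolution ((B n).normed volume) g (ContinuousLinearMap.lsmul ℝ ℝ) volume) := by
    intro n
    have hd := fun x => hw.hasDerivAt_convolution ((B n).contDiff_normed (μ := volume))
      (B n).hasCompactSupport_normed x
    refine lipschitzWith_of_nnnorm_deriv_le (fun x => (hd x).differentiableAt) fun x => ?_
    rw [(hd x).deriv, ← NNReal.coe_le_coe, coe_nnnorm]
    have hint : Integrable (fun s => (B n).normed volume (x - s) * M) :=
      ((B n).integrable_normed.comp_sub_left x).mul_const _
    refine (norm_integral_le_of_norm_le hint ?_).trans (le_of_eq ?_)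
    · filter_upwards [hM] with s hs
      rw [norm_mul, Real.norm_of_nonneg ((B n).nonneg_normed _), Real.norm_eq_abs]
      exact mul_le_mul_of_nonneg_left hs ((B n).nonneg_normed _)
    · rw [integral_mul_const, integral_sub_left_eq_self (fun s => (B n).normed volume s),
        (B n).integral_normed, one_mul]
  set A : Set ℝ := {x | Tendsto (fun n => convolution ((B n).normed volume) g
    (ContinuousLinearMap.lsmul ℝ ℝ) volume x) atTop (𝓝 (g x))} with hA
  -- The mollifications are uniformly `M`-Lipschitz, so their limit is too on the conull set of
  -- convergence; it is then extended to the whole line.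
  have hgA : LipschitzOnWith M g A := by
    refine LipschitzOnWith.of_dist_le_mul fun x hx y hy => ?_
    exact le_of_tendsto (Tendsto.dist hx hy) (Eventually.of_forall fun n => (hlip n).dist_le_mul x y)
  obtain ⟨p, hp, hpe⟩ := hgA.extend_real
  exact ⟨p, hp, by filter_upwards [hconv] with x hx using hpe hx⟩

theorem ae_eq_comp_mul_sub {φ p : ℝ → ℝ} (h : φ =ᵐ[volume] p) {a : ℝ} (ha : a ≠ 0) (c : ℝ) :
    (fun x => φ (a * x - c)) =ᵐ[volume] fun x => p (a * x - c) := by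
  have hm : Measure.QuasiMeasurePreserving (fun x : ℝ => a * x) volume volume := by
    refine ⟨measurable_const_mul _, ?_⟩
    rw [Real.map_volume_mul_left ha]
    exact Measure.smul_absolutelyContinuous
  exact ((measurePreserving_sub_right volume c).quasiMeasurePreserving.comp hm).ae h

theorem ae_eq_comp_sub {φ p : ℝ → ℝ} (h : φ =ᵐ[volume] p) (c : ℝ) :
    (fun x => φ (x - c)) =ᵐ[volume] fun x => p (x - c) :=
  (measurePreserving_sub_right volume c).quasiMeasurePreserving.ae h

theorem approxSpace_congr {φ p : ℝ → ℝ} (h : φ =ᵐ[volume] p) (j : ℤ) :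
    approxSpace φ j = approxSpace p j := by
  have hk : ∀ k : ℤ, (fun x => φ ((2 : ℝ) ^ j * x - k)) =ᵐ[volume]
      fun x => p ((2 : ℝ) ^ j * x - k) :=
    fun k => ae_eq_comp_mul_sub h (by positivity) k
  unfold approxSpace
  congr 2
  ext g
  exact exists_congr fun k => ⟨fun h => h.trans (hk k), fun h => h.trans (hk k).symm⟩

theorem IsScalingFunction.congr {φ p : ℝ → ℝ} (hφ : IsScalingFunction φ) (h : φ =ᵐ[volume] p) :
    IsScalingFunction p where
  memLp := hφ.memLp.ae_eq h
  orthonormal k l := by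
    rw [← hφ.orthonormal k l]
    refine integral_congr_ae ?_
    filter_upwards [ae_eq_comp_sub h k, ae_eq_comp_sub h l] with x h1 h2
    rw [h1, h2]
  nested j := by simpa only [approxSpace_congr h] using hφ.nested j
  dense := by simpa only [approxSpace_congr h] using hφ.dense

theorem IsRegular.congr {s : ℕ} {φ p : ℝ → ℝ} (hφ : IsRegular s φ) (h : φ =ᵐ[volume] p) :
    IsRegular s p := by
  obtain ⟨c₁, c₂, lam, h1, h2, h3, h4, H⟩ := hφ
  refine ⟨c₁, c₂, lam, h1, h2, h3, h4, fun a ha => ?_⟩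
  obtain ⟨g, hg, hb⟩ := H a ha
  refine ⟨g, ⟨hg.locallyIntegrable.congr h, hg.locallyIntegrable_deriv, fun η hη hc => ?_⟩, hb⟩
  rw [← hg.integral_eq η hη hc]
  refine integral_congr_ae ?_
  filter_upwards [h] with x hx
  rw [hx]

theorem filterCoeff_congr {φ p : ℝ → ℝ} (h : φ =ᵐ[volume] p) (k : ℤ) :
    filterCoeff φ k = filterCoeff p k := by
  refine integral_congr_ae ?_
  filter_upwards [h, ae_eq_comp_mul_sub h two_ne_zero k] with x h1 h2
  rw [h1, h2]

theorem mother_congr {φ p : ℝ → ℝ} (h : φ =ᵐ[volume] p) : mother φ =ᵐ[volume] mother p := by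
  filter_upwards [ae_all_iff.2 fun k : ℤ => ae_eq_comp_mul_sub h two_ne_zero (k : ℝ)] with x hx
  simp only [mother, filterCoeff_congr h, hx]

theorem waveletFun_congr {φ p : ℝ → ℝ} (h : φ =ᵐ[volume] p) (l : ℕ) (k : ℤ) :
    waveletFun φ l k =ᵐ[volume] waveletFun p l k := by
  filter_upwards [ae_eq_comp_mul_sub (mother_congr h) (pow_ne_zero l two_ne_zero) (k : ℝ)]
    with x hx
  simp only [waveletFun, hx]

theorem alpha_congr {φ p : ℝ → ℝ} (h : φ =ᵐ[volume] p) (k : ℤ) (f : ℝ → ℝ) :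
    alpha φ k f = alpha p k f := by
  refine integral_congr_ae ?_
  filter_upwards [ae_eq_comp_sub h k] with x hx
  rw [hx]

theorem beta_congr {φ p : ℝ → ℝ} (h : φ =ᵐ[volume] p) (l : ℕ) (k : ℤ) (f : ℝ → ℝ) :
    beta φ l k f = beta p l k f := by
  refine integral_congr_ae ?_
  filter_upwards [waveletFun_congr h l k] with x hx
  rw [hx]

/-- Only a.e. equality can be expected: the kernel samples `φ` at the points `2^j y - k`, so a null
set may affect individual `y`. -/
theorem proj_congr {φ p : ℝ → ℝ} (h : φ =ᵐ[volume] p) (j : ℕ) (f : ℝ → ℝ) :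
    proj φ j f =ᵐ[volume] proj p j f := by
  have h2 : ∀ᵐ x, ∀ k : ℤ, φ ((2 : ℝ) ^ j * x - k) = p ((2 : ℝ) ^ j * x - k) :=
    ae_all_iff.2 fun k => ae_eq_comp_mul_sub h (pow_ne_zero j two_ne_zero) (k : ℝ)
  filter_upwards [h2] with y hy
  refine integral_congr_ae ?_
  filter_upwards [h2] with x hx
  simp only [kernel, hy, hx]

/-- A regular scaling function of positive order has a continuous representative which decays
exponentially at every point. -/
theorem RegularScalingFunction.exists_continuous {s : ℕ} (Φ : RegularScalingFunction s)
    (hs : 1 ≤ s) : ∃ Ψ : RegularScalingFunction s, Φ.toFun =ᵐ[volume] Ψ.toFun ∧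
      Continuous Ψ.toFun ∧ ∃ C b : ℝ, 0 < C ∧ 0 < b ∧
        ∀ x, |Ψ.toFun x| ≤ C * Real.exp (-b * |x|) := by
  obtain ⟨p, hpc, hp⟩ : ∃ p : ℝ → ℝ, Continuous p ∧ Φ.toFun =ᵐ[volume] p := by
    obtain ⟨c₁, c₂, lam, h1, h2, h3, h4, H⟩ := Φ.isRegular
    obtain ⟨h, hw, hb⟩ := H 1 hs
    obtain ⟨p, hpl, hp⟩ := hw.exists_lipschitzWith (M := ⟨c₁, h1.le⟩) (by
      filter_upwards [hb] with x hx
      refine hx.trans (mul_le_of_le_one_right h1.le ?_)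
      exact Real.rpow_le_one h3.le h4.le (by positivity))
    exact ⟨p, hpl.continuous, hp⟩
  refine ⟨⟨p, Φ.isScalingFunction.congr hp, Φ.isRegular.congr hp⟩, hp, hpc, ?_⟩
  obtain ⟨C, b, hC, hb, hbd⟩ := Φ.exists_bound
  refine ⟨C, b, hC, hb, ?_⟩
  have hae : ∀ᵐ x, |p x| ≤ C * Real.exp (-b * |x|) := by
    filter_upwards [hbd, hp] with x hx hx'
    rwa [← hx']
  -- An a.e. inequality between continuous functions holds on a closed dense set, hence everywhere.
  have hcl : IsClosed {x | |p x| ≤ C * Real.exp (-b * |x|)} :=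
    isClosed_le hpc.abs (by fun_prop)
  intro x
  exact hcl.closure_subset (Measure.dense_of_ae hae x)

end Wavelet

end

/-! ### Orthogonality relations for wavelets -/

noncomputable section

namespace Wavelet

open Filter Topology
open scoped InnerProductSpace

/-- Summable coefficients make the series converge absolutely to some `S`. Then `x - S` is
orthogonal to every `v i` yet lies in their closed span, so it vanishes. -/
theorem hasSum_inner_smul_of_mem_closure_span {ι E : Type*} [NormedAddCommGroup E]
    [InnerProductSpace ℝ E] [CompleteSpace E] {v : ι → E} (hv : Orthonormal ℝ v) {x : E}
    (hx : x ∈ (Submodule.span ℝ (Set.range v)).topologicalClosure)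
    (hs : Summable fun i => ⟪v i, x⟫_ℝ) : HasSum (fun i => ⟪v i, x⟫_ℝ • v i) x := by
  classical
  have hsum : Summable fun i => ⟪v i, x⟫_ℝ • v i := by
    refine Summable.of_norm ?_
    simpa [norm_smul, hv.1] using hs.abs
  obtain ⟨S, hS⟩ := hsum
  set K := (Submodule.span ℝ (Set.range v)).topologicalClosure with hK
  have hSK : S ∈ K := by
    refine (Submodule.isClosed_topologicalClosure _).mem_of_tendsto hS
      (Eventually.of_forall fun s => ?_)
    exact K.sum_mem fun i _ => K.smul_mem _
      (Submodule.le_topologicalClosure _ (Submodule.subset_span ⟨i, rfl⟩))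
  have hi : ∀ i, ⟪v i, x - S⟫_ℝ = 0 := by
    intro i
    have h1 : HasSum (fun j => ⟪v j, x⟫_ℝ * ⟪v i, v j⟫_ℝ) ⟪v i, S⟫_ℝ := by
      simpa [inner_smul_right] using hS.mapL (innerSL ℝ (v i))
    have h2 : HasSum (fun j => ⟪v j, x⟫_ℝ * ⟪v i, v j⟫_ℝ) ⟪v i, x⟫_ℝ := by
      have := hasSum_single (f := fun j => ⟪v j, x⟫_ℝ * ⟪v i, v j⟫_ℝ) i fun j hj => by
        simp [hv.2 hj.symm]
      simpa [hv.1] using this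
    rw [inner_sub_right, h1.unique h2, sub_self]
  have hle : K ≤ (ℝ ∙ (x - S))ᗮ := by
    refine Submodule.topologicalClosure_minimal _ ?_ (Submodule.isClosed_orthogonal _)
    rw [Submodule.span_le]
    rintro _ ⟨i, rfl⟩
    exact Submodule.mem_orthogonal_singleton_iff_inner_left.2 (hi i)
  have h0 := Submodule.mem_orthogonal_singleton_iff_inner_left.1 (hle (K.sub_mem hx hSK))
  rwa [← sub_eq_zero.1 (inner_self_eq_zero.1 h0)] at hS

/-- The dilates `g_{jk}(x) = 2^{j/2} g(2^j x - k)`. -/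
def dilate (g : ℝ → ℝ) (j : ℕ) (k : ℤ) (x : ℝ) : ℝ :=
  (2 : ℝ) ^ ((j : ℝ) / 2) * g ((2 : ℝ) ^ j * x - k)

theorem two_rpow_half_mul_self (j : ℕ) :
    (2 : ℝ) ^ ((j : ℝ) / 2) * (2 : ℝ) ^ ((j : ℝ) / 2) = 2 ^ j := by
  rw [← Real.rpow_add two_pos, add_halves, Real.rpow_natCast]

theorem two_rpow_half_succ (j : ℕ) :
    (2 : ℝ) ^ (((j + 1 : ℕ) : ℝ) / 2) = (2 : ℝ) ^ ((j : ℝ) / 2) * √2 := by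
  rw [Real.sqrt_eq_rpow, ← Real.rpow_add two_pos]
  congr 1
  push_cast
  ring

theorem integral_pow_mul_comp (G : ℝ → ℝ) (j : ℕ) (c : ℝ) :
    ∫ x, (2 : ℝ) ^ j * G ((2 : ℝ) ^ j * x - c) = ∫ x, G x := by
  have h2 : (0 : ℝ) < 2 ^ j := by positivity
  rw [integral_const_mul, Measure.integral_comp_mul_left (fun x => G (x - c)),
    integral_sub_right_eq_self, abs_of_pos (inv_pos.2 h2), smul_eq_mul,
    mul_inv_cancel_left₀ h2.ne']

theorem integral_dilate_mul_dilate (g h : ℝ → ℝ) (j : ℕ) (k m : ℤ) :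
    ∫ x, dilate g j k x * dilate h j m x = ∫ x, g (x - k) * h (x - m) := by
  rw [← integral_pow_mul_comp (fun x => g (x - k) * h (x - m)) j 0]
  refine integral_congr_ae (Eventually.of_forall fun x => ?_)
  simp only [dilate, ← two_rpow_half_mul_self, sub_zero]
  ring

theorem integral_dilate_mul_dilate_succ (g h : ℝ → ℝ) (j : ℕ) (n m : ℤ) :
    ∫ x, dilate g j n x * dilate h (j + 1) m x =
      ∫ x, g x * (√2 * h (2 * x - (m - 2 * n : ℤ))) := by
  rw [← integral_pow_mul_comp (fun x => g x * (√2 * h (2 * x - (m - 2 * n : ℤ)))) j n]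
  refine integral_congr_ae (Eventually.of_forall fun x => ?_)
  have : (2 : ℝ) ^ (j + 1) * x - m = 2 * (2 ^ j * x - n) - (m - 2 * n : ℤ) := by
    push_cast
    ring
  simp only [dilate, two_rpow_half_succ, this]
  linear_combination (g (2 ^ j * x - n) * √2 * h (2 * (2 ^ j * x - n) - (m - 2 * n : ℤ))) *
    two_rpow_half_mul_self j

theorem memLp_dilate {g : ℝ → ℝ} (hg : MemLp g 2 volume) (j : ℕ) (k : ℤ) :
    MemLp (dilate g j k) 2 volume := by
  have h2 : (2 : ℝ) ^ j ≠ 0 := by positivity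
  have hm : Measure.QuasiMeasurePreserving (fun x : ℝ => (2 : ℝ) ^ j * x) volume volume := by
    refine ⟨measurable_const_mul _, ?_⟩
    rw [Real.map_volume_mul_left h2]
    exact Measure.smul_absolutelyContinuous
  have hm2 := (measurePreserving_sub_right volume (k : ℝ)).quasiMeasurePreserving.comp hm
  refine MemLp.const_mul (f := fun x => g ((2 : ℝ) ^ j * x - k)) ?_ _
  refine (memLp_two_iff_integrable_sq
    (hg.aestronglyMeasurable.comp_quasiMeasurePreserving hm2)).2 ?_
  exact ((hg.integrable_sq.comp_sub_right (k : ℝ)).comp_mul_left' h2)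

/-- The coefficients of the mother wavelet in the basis `√2 φ(2 · - k)`. -/
def waveletCoeff (φ : ℝ → ℝ) (k : ℤ) : ℝ := (-1) ^ (k + 1) * filterCoeff φ (1 - k)

theorem waveletFun_eq_tsum (φ : ℝ → ℝ) (l : ℕ) (n : ℤ) (x : ℝ) :
    waveletFun φ l n x = ∑' m : ℤ, waveletCoeff φ m * dilate φ (l + 1) (2 * n + m) x := by
  simp only [waveletFun, mother, ← tsum_mul_left]
  refine tsum_congr fun m => ?_
  have : (2 : ℝ) ^ (l + 1) * x - (2 * n + m : ℤ) = 2 * (2 ^ l * x - n) - m := by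
    push_cast
    ring
  simp only [waveletCoeff, dilate, two_rpow_half_succ, this]
  ring

namespace RegularScalingFunction

variable {s : ℕ} (Φ : RegularScalingFunction s)

theorem summable_waveletCoeff : Summable (waveletCoeff Φ.toFun) := by
  refine Summable.of_norm ?_
  have := (Equiv.subLeft (1 : ℤ)).summable_iff.2 Φ.summable_filterCoeff.norm
  refine this.congr fun k => ?_
  simp [waveletCoeff, norm_zpow]

/-- `φ_{jk}` as a vector in `L²`. -/
def scalingVec (j : ℕ) (k : ℤ) : Lp ℝ 2 (volume : Measure ℝ) :=
  (memLp_dilate Φ.isScalingFunction.memLp j k).toLp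

theorem coeFn_scalingVec (j : ℕ) (k : ℤ) : Φ.scalingVec j k =ᵐ[volume] dilate Φ.toFun j k :=
  MemLp.coeFn_toLp _

theorem inner_eq_integral {u v : Lp ℝ 2 (volume : Measure ℝ)} {f g : ℝ → ℝ}
    (hu : u =ᵐ[volume] f) (hv : v =ᵐ[volume] g) : ⟪u, v⟫_ℝ = ∫ x, f x * g x := by
  rw [L2.inner_def]
  refine integral_congr_ae ?_
  filter_upwards [hu, hv] with x h1 h2
  simp [h1, h2, mul_comm]

theorem orthonormal_scalingVec (j : ℕ) : Orthonormal ℝ (Φ.scalingVec j) := by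
  rw [orthonormal_iff_ite]
  intro k m
  rw [inner_eq_integral (Φ.coeFn_scalingVec j k) (Φ.coeFn_scalingVec j m),
    integral_dilate_mul_dilate, Φ.isScalingFunction.orthonormal]

theorem inner_scalingVec_succ (j : ℕ) (n m : ℤ) :
    ⟪Φ.scalingVec j n, Φ.scalingVec (j + 1) m⟫_ℝ = filterCoeff Φ.toFun (m - 2 * n) := by
  rw [inner_eq_integral (Φ.coeFn_scalingVec j n) (Φ.coeFn_scalingVec (j + 1) m),
    integral_dilate_mul_dilate_succ]
  rfl

theorem approxSpace_eq (j : ℕ) : approxSpace Φ.toFun j =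
    (Submodule.span ℝ (Set.range (Φ.scalingVec j))).topologicalClosure := by
  unfold approxSpace
  congr 1
  have h2 : (2 : ℝ) ^ ((j : ℝ) / 2) ≠ 0 := by positivity
  apply le_antisymm
  · rw [Submodule.span_le]
    rintro g ⟨k, hg⟩
    have : g = ((2 : ℝ) ^ ((j : ℝ) / 2))⁻¹ • Φ.scalingVec j k := by
      refine Lp.ext ?_
      filter_upwards [hg, Lp.coeFn_smul ((2 : ℝ) ^ ((j : ℝ) / 2))⁻¹ (Φ.scalingVec j k),
        Φ.coeFn_scalingVec j k] with x h3 h4 h5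
      rw [h3, h4, Pi.smul_apply, h5, dilate, smul_eq_mul, inv_mul_cancel_left₀ h2, zpow_natCast]
    rw [this]
    exact Submodule.smul_mem _ _ (Submodule.subset_span ⟨k, rfl⟩)
  · rw [Submodule.span_le]
    rintro _ ⟨k, rfl⟩
    have : Φ.scalingVec j k = ((2 : ℝ) ^ ((j : ℝ) / 2)) •
        (((2 : ℝ) ^ ((j : ℝ) / 2))⁻¹ • Φ.scalingVec j k) := by
      rw [smul_inv_smul₀ h2]
    rw [this]
    refine Submodule.smul_mem _ _ (Submodule.subset_span ⟨k, ?_⟩)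
    filter_upwards [Lp.coeFn_smul ((2 : ℝ) ^ ((j : ℝ) / 2))⁻¹ (Φ.scalingVec j k),
        Φ.coeFn_scalingVec j k] with x h4 h5
    rw [h4, Pi.smul_apply, h5, dilate, smul_eq_mul, inv_mul_cancel_left₀ h2, zpow_natCast]

theorem approxSpace_mono {i j : ℕ} (h : i ≤ j) : approxSpace Φ.toFun i ≤ approxSpace Φ.toFun j := by
  induction j, h using Nat.le_induction with
  | base => exact le_rfl
  | succ j _ ih => exact ih.trans (by exact_mod_cast Φ.isScalingFunction.nested j)

theorem scalingVec_mem (j : ℕ) (k : ℤ) : Φ.scalingVec j k ∈ approxSpace Φ.toFun j := by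
  rw [approxSpace_eq]
  exact Submodule.le_topologicalClosure _ (Submodule.subset_span ⟨k, rfl⟩)

/-- `ψ_{ln}` as a vector in `L²`. -/
def waveletVec (l : ℕ) (n : ℤ) : Lp ℝ 2 (volume : Measure ℝ) :=
  ∑' m : ℤ, waveletCoeff Φ.toFun m • Φ.scalingVec (l + 1) (2 * n + m)

theorem summable_norm_waveletVec (l : ℕ) (n : ℤ) : Summable fun m : ℤ =>
    ‖waveletCoeff Φ.toFun m • Φ.scalingVec (l + 1) (2 * n + m)‖ := by
  simpa [norm_smul, (Φ.orthonormal_scalingVec (l + 1)).1] using Φ.summable_waveletCoeff.abs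

theorem hasSum_waveletVec (l : ℕ) (n : ℤ) :
    HasSum (fun m : ℤ => waveletCoeff Φ.toFun m • Φ.scalingVec (l + 1) (2 * n + m))
      (Φ.waveletVec l n) :=
  (Φ.summable_norm_waveletVec l n).of_norm.hasSum

/-- Absolute convergence in `L²` forces a.e. pointwise convergence to the same limit, which
identifies the `L²` sum with the pointwise series defining `ψ`. -/
theorem coeFn_waveletVec (l : ℕ) (n : ℤ) :
    Φ.waveletVec l n =ᵐ[volume] waveletFun Φ.toFun l n := by
  have h : ∑' m : ℤ, ‖waveletCoeff Φ.toFun m • Φ.scalingVec (l + 1) (2 * n + m)‖ₑ ≠ ⊤ := by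
    simpa only [← ofReal_norm] using (Φ.summable_norm_waveletVec l n).tsum_ofReal_ne_top
  filter_upwards [Lp.hasSum_coeFn_tsum h,
    ae_all_iff.2 fun m : ℤ => Lp.coeFn_smul (waveletCoeff Φ.toFun m)
      (Φ.scalingVec (l + 1) (2 * n + m)),
    ae_all_iff.2 fun m : ℤ => Φ.coeFn_scalingVec (l + 1) (2 * n + m)] with x h1 h2 h3
  rw [waveletFun_eq_tsum]
  refine h1.tsum_eq.symm.trans (tsum_congr fun m => ?_)
  rw [h2, Pi.smul_apply, h3, smul_eq_mul]

theorem waveletVec_mem (l : ℕ) (n : ℤ) :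
    Φ.waveletVec l n ∈ approxSpace Φ.toFun ((l + 1 : ℕ) : ℤ) := by
  refine (Submodule.isClosed_topologicalClosure _).mem_of_tendsto (Φ.hasSum_waveletVec l n)
    (Eventually.of_forall fun S => ?_)
  exact Submodule.sum_mem _ fun m _ => Submodule.smul_mem _ _ (Φ.scalingVec_mem _ _)

theorem hasSum_inner_waveletVec (v : Lp ℝ 2 (volume : Measure ℝ)) (l : ℕ) (n : ℤ) :
    HasSum (fun m : ℤ => waveletCoeff Φ.toFun m * ⟪v, Φ.scalingVec (l + 1) (2 * n + m)⟫_ℝ)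
      ⟪v, Φ.waveletVec l n⟫_ℝ := by
  simpa [inner_smul_right] using (Φ.hasSum_waveletVec l n).mapL (innerSL ℝ v)

/-- The involution `m ↦ 1 - 2(n - k) - m` exchanges the two filter factors in each summand and flips
the alternating sign, so the sum equals its own negative. -/
theorem inner_scalingVec_waveletVec (j : ℕ) (k n : ℤ) :
    ⟪Φ.scalingVec j k, Φ.waveletVec j n⟫_ℝ = 0 := by
  have h := Φ.hasSum_inner_waveletVec (Φ.scalingVec j k) j n
  simp only [inner_scalingVec_succ] at h
  have h2 := (Equiv.subLeft (1 - 2 * (n - k))).hasSum_iff.2 h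
  have h3 := h.neg
  have heq : (fun m : ℤ => -(waveletCoeff Φ.toFun m * filterCoeff Φ.toFun (2 * n + m - 2 * k))) =
      (fun m => waveletCoeff Φ.toFun m * filterCoeff Φ.toFun (2 * n + m - 2 * k)) ∘
        (Equiv.subLeft (1 - 2 * (n - k))) := by
    funext m
    have e1 : (1 : ℤ) - (1 - 2 * (n - k) - m) = 2 * n + m - 2 * k := by ring
    have e2 : 2 * n + (1 - 2 * (n - k) - m) - 2 * k = 1 - m := by ring
    have e3 : ((-1 : ℝ)) ^ (1 - 2 * (n - k) - m + 1) = -(-1) ^ (m + 1) := by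
      have : 1 - 2 * (n - k) - m + 1 = (m + 1) + (1 + 2 * (k - n - m)) := by ring
      rw [this, zpow_add₀ (by norm_num), zpow_add₀ (a := (-1 : ℝ)) (by norm_num) 1, zpow_mul]
      simp
    simp only [Function.comp, Equiv.subLeft_apply, waveletCoeff, e1, e2, e3]
    ring
  rw [heq] at h3
  linarith [h2.unique h3]

theorem inner_waveletVec_of_mem {l : ℕ} (n : ℤ) {v : Lp ℝ 2 (volume : Measure ℝ)}
    (hv : v ∈ approxSpace Φ.toFun l) : ⟪v, Φ.waveletVec l n⟫_ℝ = 0 := by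
  have hle : approxSpace Φ.toFun l ≤ (ℝ ∙ Φ.waveletVec l n)ᗮ := by
    rw [approxSpace_eq]
    refine Submodule.topologicalClosure_minimal _ ?_ (Submodule.isClosed_orthogonal _)
    rw [Submodule.span_le]
    rintro _ ⟨k, rfl⟩
    exact Submodule.mem_orthogonal_singleton_iff_inner_left.2 (Φ.inner_scalingVec_waveletVec l k n)
  exact Submodule.mem_orthogonal_singleton_iff_inner_left.1 (hle hv)

theorem inner_waveletVec_of_lt {l i : ℕ} (h : i < l) (k n : ℤ) :
    ⟪Φ.waveletVec i k, Φ.waveletVec l n⟫_ℝ = 0 :=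
  Φ.inner_waveletVec_of_mem n (Φ.approxSpace_mono (Nat.succ_le_of_lt h) (Φ.waveletVec_mem i k))

/-- Since `φ ∈ V_0 ⊆ V_1`, the refinement equation `φ = ∑ h_m φ_{1m}` holds in `L²`; pairing it with
`φ_{0d}` turns orthonormality of the translates into this identity. -/
theorem hasSum_filterCoeff_mul (d : ℤ) :
    HasSum (fun m : ℤ => filterCoeff Φ.toFun m * filterCoeff Φ.toFun (m - 2 * d))
      (if d = 0 then 1 else 0) := by
  have hi : ∀ m, ⟪Φ.scalingVec 1 m, Φ.scalingVec 0 0⟫_ℝ = filterCoeff Φ.toFun m := fun m => by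
    rw [real_inner_comm, Φ.inner_scalingVec_succ 0, mul_zero, sub_zero]
  have hmem : Φ.scalingVec 0 0 ∈
      (Submodule.span ℝ (Set.range (Φ.scalingVec 1))).topologicalClosure := by
    rw [← approxSpace_eq]
    exact Φ.approxSpace_mono zero_le_one (Φ.scalingVec_mem 0 0)
  have h := hasSum_inner_smul_of_mem_closure_span (Φ.orthonormal_scalingVec 1) hmem
    (by simpa only [hi] using Φ.summable_filterCoeff)
  have h2 := h.mapL (innerSL ℝ (Φ.scalingVec 0 d))
  simpa [hi, inner_smul_right, Φ.inner_scalingVec_succ 0,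
    orthonormal_iff_ite.1 (Φ.orthonormal_scalingVec 0)] using h2

theorem inner_waveletVec_scalingVec_succ (l : ℕ) (n q : ℤ) :
    ⟪Φ.scalingVec (l + 1) q, Φ.waveletVec l n⟫_ℝ = waveletCoeff Φ.toFun (q - 2 * n) := by
  refine (Φ.hasSum_inner_waveletVec _ l n).unique ?_
  simp only [orthonormal_iff_ite.1 (Φ.orthonormal_scalingVec (l + 1))]
  have := hasSum_single (f := fun m : ℤ =>
    waveletCoeff Φ.toFun m * if q = 2 * n + m then 1 else 0) (q - 2 * n) fun m hm => by
      rw [if_neg (fun h => hm (by omega)), mul_zero]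
  simpa using this

/-- The reflection `m ↦ 1 - m` reduces this to the filter identity: the two indices differ by an
even number, so the alternating signs agree and square to 1. -/
theorem inner_waveletVec (l : ℕ) (k n : ℤ) :
    ⟪Φ.waveletVec l k, Φ.waveletVec l n⟫_ℝ = if k = n then 1 else 0 := by
  refine (Φ.hasSum_inner_waveletVec _ l n).unique ?_
  have h := (Equiv.subLeft (1 : ℤ)).hasSum_iff.2 (Φ.hasSum_filterCoeff_mul (n - k))
  convert h using 1
  · funext m
    have e1 : (-1 : ℝ) ^ (2 * n + m - 2 * k + 1) = (-1) ^ (m + 1) := by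
      have : 2 * n + m - 2 * k + 1 = (m + 1) + 2 * (n - k) := by ring
      rw [this, zpow_add₀ (by norm_num), zpow_mul]
      simp
    have e2 : 1 - (2 * n + m - 2 * k) = 1 - m - 2 * (n - k) := by ring
    have e3 : (-1 : ℝ) ^ (m + 1) * (-1) ^ (m + 1) = 1 := by
      rw [← mul_zpow]
      simp
    rw [real_inner_comm, inner_waveletVec_scalingVec_succ]
    simp only [Function.comp, Equiv.subLeft_apply, waveletCoeff, e1, e2]
    linear_combination (filterCoeff Φ.toFun (1 - m) *
      filterCoeff Φ.toFun (1 - m - 2 * (n - k))) * e3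
  · simp only [sub_eq_zero, eq_comm]

theorem integral_waveletFun_mul (l i : ℕ) (k n : ℤ) :
    ∫ x, waveletFun Φ.toFun l k x * waveletFun Φ.toFun i n x =
      if l = i ∧ k = n then 1 else 0 := by
  rw [← inner_eq_integral (Φ.coeFn_waveletVec l k) (Φ.coeFn_waveletVec i n)]
  rcases lt_trichotomy l i with h | rfl | h
  · rw [inner_waveletVec_of_lt _ h, if_neg (by omega)]
  · simpa using Φ.inner_waveletVec l k n
  · rw [real_inner_comm, inner_waveletVec_of_lt _ h, if_neg (by omega)]

theorem integral_dilate_mul_waveletFun {j l : ℕ} (h : j ≤ l) (k n : ℤ) :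
    ∫ x, dilate Φ.toFun j k x * waveletFun Φ.toFun l n x = 0 := by
  rw [← inner_eq_integral (Φ.coeFn_scalingVec j k) (Φ.coeFn_waveletVec l n)]
  exact Φ.inner_waveletVec_of_mem n (Φ.approxSpace_mono h (Φ.scalingVec_mem j k))

end RegularScalingFunction

end Wavelet

end

/-! ### The kernel operators and the lower bound for the approximation error -/

noncomputable section

namespace Wavelet

open Filter Topology

/-- Replacing `x` by `⌊x⌋` costs a factor `e^b`, and shifting the index by `⌊x⌋` makes the
dominating series independent of `x`. -/
theorem exists_tsum_translates_bound {p : ℝ → ℝ} {C b : ℝ} (hC : 0 < C) (hb : 0 < b)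
    (hp : ∀ x, |p x| ≤ C * Real.exp (-b * |x|)) :
    ∃ M : ℝ, ∀ x, (Summable fun m : ℤ => |p (x - m)|) ∧
      ∑' m : ℤ, |p (x - m)| ≤ M := by
  have hs := (summable_exp_neg_mul_abs hb).mul_left (C * Real.exp b)
  refine ⟨∑' m : ℤ, C * Real.exp b * Real.exp (-b * |(m : ℝ)|),
    fun x => ?_⟩
  have hs2 := (Equiv.subRight ⌊x⌋).summable_iff.2 hs
  have hle : ∀ m : ℤ, |p (x - m)| ≤
      ((fun m : ℤ => C * Real.exp b * Real.exp (-b * |(m : ℝ)|)) ∘ Equiv.subRight ⌊x⌋) m := by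
    intro m
    refine (hp _).trans ?_
    simp only [Function.comp, Equiv.subRight_apply]
    rw [mul_assoc, ← Real.exp_add]
    refine mul_le_mul_of_nonneg_left (Real.exp_le_exp.2 ?_) hC.le
    have h1 : |((m - ⌊x⌋ : ℤ) : ℝ)| ≤ |x - m| + 1 := by
      have h2 : ((m - ⌊x⌋ : ℤ) : ℝ) = -(x - m) + (x - ⌊x⌋) := by
        push_cast
        ring
      rw [h2]
      refine (abs_add_le _ _).trans ?_
      rw [abs_neg, abs_of_nonneg (sub_nonneg.2 (Int.floor_le x))]
      linarith [Int.lt_floor_add_one x]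
    nlinarith
  have hs3 : Summable fun m : ℤ => |p (x - m)| :=
    Summable.of_nonneg_of_le (fun m => abs_nonneg _) hle hs2
  refine ⟨hs3, (hs3.tsum_le_tsum hle hs2).trans (le_of_eq ?_)⟩
  exact (Equiv.subRight ⌊x⌋).tsum_eq
    (fun m : ℤ => C * Real.exp b * Real.exp (-b * |(m : ℝ)|))

theorem summable_abs_dilate {p : ℝ → ℝ} {M : ℝ}
    (hp : ∀ x, (Summable fun m : ℤ => |p (x - m)|) ∧ ∑' m : ℤ, |p (x - m)| ≤ M)
    (j : ℕ) (y : ℝ) : (Summable fun m : ℤ => |dilate p j m y|) ∧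
      ∑' m : ℤ, |dilate p j m y| ≤ (2 : ℝ) ^ ((j : ℝ) / 2) * M := by
  have h2 : (0 : ℝ) ≤ 2 ^ ((j : ℝ) / 2) := by positivity
  simp only [dilate, abs_mul, abs_of_nonneg h2]
  refine ⟨(hp _).1.mul_left _, ?_⟩
  rw [tsum_mul_left]
  exact mul_le_mul_of_nonneg_left (hp _).2 h2

theorem integral_abs_dilate (g : ℝ → ℝ) (j : ℕ) (k : ℤ) :
    (2 : ℝ) ^ ((j : ℝ) / 2) * ∫ x, |dilate g j k x| = ∫ x, |g x| := by
  have h2 : (0 : ℝ) ≤ 2 ^ ((j : ℝ) / 2) := by positivity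
  rw [← integral_pow_mul_comp (fun x => |g x|) j k, ← integral_const_mul]
  simp only [dilate, abs_mul, abs_of_nonneg h2, ← mul_assoc, two_rpow_half_mul_self]

theorem integrable_dilate {g : ℝ → ℝ} (hg : Integrable g) (j : ℕ) (k : ℤ) :
    Integrable (dilate g j k) :=
  ((hg.comp_sub_right (k : ℝ)).comp_mul_left' (pow_ne_zero j two_ne_zero)).const_mul _

theorem norm_integral_mul_bcf_le {g : ℝ → ℝ} (hg : Integrable g) (f : ℝ →ᵇ ℝ) :
    |∫ x, g x * f x| ≤ (∫ x, |g x|) * ‖f‖ := by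
  rw [← integral_mul_const, ← Real.norm_eq_abs]
  refine norm_integral_le_of_norm_le (hg.abs.mul_const _) (Eventually.of_forall fun x => ?_)
  rw [norm_mul, Real.norm_eq_abs]
  exact mul_le_mul_of_nonneg_left (f.norm_coe_le_norm x) (abs_nonneg _)

/-- The integral against an integrable function, as a functional on bounded continuous functions. -/
def integralAgainst {g : ℝ → ℝ} (hg : Integrable g) : (ℝ →ᵇ ℝ) →L[ℝ] ℝ :=
  LinearMap.mkContinuous
    { toFun := fun f => ∫ x, g x * f x
      map_add' := fun f f' => by
        simp only [BoundedContinuousFunction.coe_add, Pi.add_apply, mul_add]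
        exact integral_add (integrable_mul_bcf hg f) (integrable_mul_bcf hg f')
      map_smul' := fun c f => by
        simp only [BoundedContinuousFunction.coe_smul, smul_eq_mul, ← integral_const_mul,
          RingHom.id_apply, mul_left_comm] }
    (∫ x, |g x|) (norm_integral_mul_bcf_le hg)

theorem integralAgainst_apply {g : ℝ → ℝ} (hg : Integrable g) (f : ℝ →ᵇ ℝ) :
    integralAgainst hg f = ∫ x, g x * f x := rfl

/-- The kernel operator `K_j` is the expansion in the functions `φ_{jm}`. -/
theorem proj_eq_tsum {p : ℝ → ℝ} (hint : Integrable p) {M : ℝ}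
    (hp : ∀ x, (Summable fun m : ℤ => |p (x - m)|) ∧ ∑' m : ℤ, |p (x - m)| ≤ M)
    (j : ℕ) (f : ℝ →ᵇ ℝ) (y : ℝ) :
    proj p j f y = ∑' m : ℤ, dilate p j m y * ∫ x, dilate p j m x * f x := by
  have h1 : ∀ m : ℤ, Integrable fun x => dilate p j m y * (dilate p j m x * f x) := fun m =>
    (integrable_mul_bcf (integrable_dilate hint j m) f).const_mul _
  have hI : ∀ m : ℤ, ∫ x, |dilate p j m x| = ((2 : ℝ) ^ ((j : ℝ) / 2))⁻¹ * ∫ x, |p x| := by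
    intro m
    rw [← integral_abs_dilate p j m, inv_mul_cancel_left₀ (by positivity)]
  -- The `L¹` norm of `φ_{jm}` does not depend on `m`, so summability comes from the values
  -- `|φ_{jm}(y)|` alone.
  have h2 : Summable fun m : ℤ => ∫ x, ‖dilate p j m y * (dilate p j m x * f x)‖ := by
    refine Summable.of_nonneg_of_le (fun m => integral_nonneg fun x => norm_nonneg _) (fun m => ?_)
      ((summable_abs_dilate hp j y).1.mul_right
        (((2 : ℝ) ^ ((j : ℝ) / 2))⁻¹ * (∫ x, |p x|) * ‖f‖))
    simp only [norm_mul]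
    rw [integral_const_mul, Real.norm_eq_abs, ← hI m, ← integral_mul_const]
    refine mul_le_mul_of_nonneg_left ?_ (abs_nonneg _)
    refine integral_mono ?_ ((integrable_dilate hint j m).abs.mul_const _) fun x => ?_
    · simpa only [norm_mul] using (integrable_mul_bcf (integrable_dilate hint j m) f).norm
    · exact mul_le_mul_of_nonneg_left (f.norm_coe_le_norm x) (norm_nonneg _)
  have h3 := integral_tsum_of_summable_integral_norm h1 h2
  simp only [integral_const_mul] at h3
  rw [h3, proj]
  congr 1
  funext x
  rw [kernel, ← tsum_mul_left, ← tsum_mul_right]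
  refine tsum_congr fun m => ?_
  simp only [dilate, ← two_rpow_half_mul_self]
  ring

namespace RegularScalingFunction

variable {s : ℕ} (Φ : RegularScalingFunction s)

/-- `ψ_{jn}` is orthogonal to the range of `K_j`. -/
theorem integral_waveletFun_mul_proj {M : ℝ}
    (hp : ∀ x, (Summable fun m : ℤ => |Φ.toFun (x - m)|) ∧ ∑' m : ℤ, |Φ.toFun (x - m)| ≤ M)
    (j : ℕ) (n : ℤ) (f : ℝ →ᵇ ℝ) :
    Integrable (fun y => waveletFun Φ.toFun j n y * proj Φ.toFun j f y) ∧
      ∫ y, waveletFun Φ.toFun j n y * proj Φ.toFun j f y = 0 := by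
  set p := Φ.toFun with hpdef
  set a : ℤ → ℝ := fun m => ∫ x, dilate p j m x * f x with ha
  set w := waveletFun p j n with hw
  have hwi : Integrable w := Φ.integrable_waveletFun j n
  have hdi : ∀ m, Integrable (dilate p j m) := fun m => integrable_dilate Φ.integrable j m
  set D := (2 : ℝ) ^ ((j : ℝ) / 2) with hD
  have hD0 : 0 < D := by positivity
  set A := D⁻¹ * (∫ x, |p x|) * ‖f‖ with hA
  have haA : ∀ m, |a m| ≤ A := by
    intro m
    refine (norm_integral_mul_bcf_le (hdi m) f).trans (le_of_eq ?_)
    rw [hA, ← integral_abs_dilate p j m, inv_mul_cancel_left₀ hD0.ne']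
  have hA0 : 0 ≤ A := (abs_nonneg _).trans (haA 0)
  have hsum : ∀ y, Summable fun m => |dilate p j m y * a m| := by
    intro y
    refine Summable.of_nonneg_of_le (fun m => abs_nonneg _) (fun m => ?_)
      ((summable_abs_dilate hp j y).1.mul_right A)
    rw [abs_mul]
    exact mul_le_mul_of_nonneg_left (haA m) (abs_nonneg _)
  -- Uniformity in both `S` and `y` gives boundedness of `K_j f` and, after integration against
  -- `|w|`, the exchange of sum and integral.
  have hfin : ∀ (S : Finset ℤ) y, ∑ m ∈ S, |dilate p j m y * a m| ≤ D * M * A := by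
    intro S y
    calc ∑ m ∈ S, |dilate p j m y * a m| ≤ ∑ m ∈ S, |dilate p j m y| * A := by
          refine Finset.sum_le_sum fun m _ => ?_
          rw [abs_mul]
          exact mul_le_mul_of_nonneg_left (haA m) (abs_nonneg _)
      _ = (∑ m ∈ S, |dilate p j m y|) * A := by rw [Finset.sum_mul]
      _ ≤ D * M * A := by
          refine mul_le_mul_of_nonneg_right ?_ hA0
          exact ((summable_abs_dilate hp j y).1.sum_le_tsum S fun _ _ => abs_nonneg _).trans
            (summable_abs_dilate hp j y).2
  have hproj : ∀ y, proj p j f y = ∑' m, dilate p j m y * a m :=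
    proj_eq_tsum Φ.integrable hp j f
  have hterm : ∀ m, Integrable fun y => w y * (dilate p j m y * a m) := by
    intro m
    refine hwi.mul_bdd (c := D * M * A) ((hdi m).mul_const _).aestronglyMeasurable
      (Eventually.of_forall fun y => ?_)
    simpa using hfin {m} y
  have hmeas : AEStronglyMeasurable (proj p j f) := by
    refine aestronglyMeasurable_of_tendsto_ae atTop
      (f := fun (S : Finset ℤ) y => ∑ m ∈ S, dilate p j m y * a m) (fun S => ?_)
      (Eventually.of_forall fun y => ?_)
    · exact Finset.aestronglyMeasurable_fun_sum S fun m _ =>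
        ((hdi m).mul_const _).aestronglyMeasurable
    · rw [hproj]
      exact (hsum y).of_abs.hasSum
  have hbd : ∀ y, |proj p j f y| ≤ D * M * A := by
    intro y
    rw [hproj]
    have hn : Summable fun m => ‖dilate p j m y * a m‖ := by
      simpa only [Real.norm_eq_abs] using hsum y
    refine (norm_tsum_le_tsum_norm hn).trans ?_
    simp only [Real.norm_eq_abs]
    exact (hsum y).tsum_le_of_sum_le fun S => hfin S y
  refine ⟨hwi.mul_bdd (c := D * M * A) hmeas (Eventually.of_forall fun y => ?_), ?_⟩
  · rw [Real.norm_eq_abs]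
    exact hbd y
  have hnorm : Summable fun m => ∫ y, ‖w y * (dilate p j m y * a m)‖ := by
    refine summable_of_sum_le (c := ∫ y, |w y| * (D * M * A))
      (fun m => integral_nonneg fun y => norm_nonneg _) fun S => ?_
    rw [← integral_finsetSum _ fun m _ => (hterm m).norm]
    refine integral_mono (integrable_finsetSum _ fun m _ => (hterm m).norm)
      (hwi.abs.mul_const _) fun y => ?_
    simp only [norm_mul (w y), ← Finset.mul_sum, Real.norm_eq_abs]
    exact mul_le_mul_of_nonneg_left (hfin S y) (abs_nonneg _)
  have h := integral_tsum_of_summable_integral_norm hterm hnorm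
  simp only [tsum_mul_left, ← hproj] at h
  rw [← h]
  refine (tsum_congr fun m => ?_).trans tsum_zero
  have h0 := Φ.integral_dilate_mul_waveletFun (le_refl j) m n
  calc ∫ y, w y * (dilate p j m y * a m) = ∫ y, a m * (dilate p j m y * w y) := by
        congr 1
        funext y
        ring
    _ = 0 := by rw [integral_const_mul, h0, mul_zero]

/-- The approximation error at scale `j` dominates the wavelet coefficients at scale `j`. -/
theorem abs_beta_le_eSupNorm {M : ℝ}
    (hp : ∀ x, (Summable fun m : ℤ => |Φ.toFun (x - m)|) ∧ ∑' m : ℤ, |Φ.toFun (x - m)| ≤ M)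
    {φ : ℝ → ℝ} (hφ : φ =ᵐ[volume] Φ.toFun) (j : ℕ) (n : ℤ) (f : ℝ →ᵇ ℝ) :
    ENNReal.ofReal (((∫ x, |mother Φ.toFun x|) + 1)⁻¹ *
        ((2 : ℝ) ^ ((j : ℝ) / 2) * |beta Φ.toFun j n f|)) ≤
      eSupNorm fun y => proj φ j f y - f y := by
  set N := eSupNorm fun y => proj φ j f y - f y with hN
  rcases eq_or_ne N ⊤ with htop | htop
  · rw [htop]
    exact le_top
  have hI0 : 0 ≤ ∫ x, |mother Φ.toFun x| := integral_nonneg fun x => abs_nonneg _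
  refine ENNReal.ofReal_le_of_le_toReal ?_
  have hle : ∀ y, |proj φ j f y - f y| ≤ N.toReal := by
    intro y
    have : ‖proj φ j f y - f y‖ₑ ≤ N := le_iSup (fun y => ‖proj φ j f y - f y‖ₑ) y
    simpa using ENNReal.toReal_mono htop this
  obtain ⟨h1, h2⟩ := Φ.integral_waveletFun_mul_proj hp j n f
  have hwi := Φ.integrable_waveletFun j n
  have h3 : beta Φ.toFun j n f =
      ∫ y, waveletFun Φ.toFun j n y * (f y - proj Φ.toFun j f y) := by
    simp only [mul_sub]
    rw [integral_sub (integrable_mul_bcf hwi f) h1, h2, sub_zero, beta]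
  have h4 : |beta Φ.toFun j n f| ≤ (∫ y, |waveletFun Φ.toFun j n y|) * N.toReal := by
    rw [h3, ← integral_mul_const, ← Real.norm_eq_abs]
    refine norm_integral_le_of_norm_le (hwi.abs.mul_const _) ?_
    filter_upwards [proj_congr hφ j f] with y hy
    rw [norm_mul, Real.norm_eq_abs, Real.norm_eq_abs, ← hy, abs_sub_comm]
    exact mul_le_mul_of_nonneg_left (hle y) (abs_nonneg _)
  have h5 := integral_abs_dilate (mother Φ.toFun) j n
  -- The `+ 1` makes the constant invertible without having to show `‖ψ‖₁ ≠ 0`.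
  rw [inv_mul_le_iff₀ (by positivity)]
  calc (2 : ℝ) ^ ((j : ℝ) / 2) * |beta Φ.toFun j n f|
      ≤ (2 : ℝ) ^ ((j : ℝ) / 2) * ((∫ y, |waveletFun Φ.toFun j n y|) * N.toReal) := by gcongr
    _ = (∫ x, |mother Φ.toFun x|) * N.toReal := by
        rw [← mul_assoc]
        exact congrArg (· * N.toReal) h5
    _ ≤ _ := by
        gcongr
        linarith

end RegularScalingFunction

end Wavelet

end

/-! ### An open dense set of functions with large coefficients -/

noncomputable section

namespace Wavelet

open Filter Topology

namespace RegularScalingFunction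

variable {s : ℕ} (Φ : RegularScalingFunction s)

theorem continuous_mother (hc : Continuous Φ.toFun) {C : ℝ} (hC : ∀ x, |Φ.toFun x| ≤ C) :
    Continuous (mother Φ.toFun) ∧
      ∀ x, |mother Φ.toFun x| ≤ √2 * ∑' k, |waveletCoeff Φ.toFun k| * C := by
  have hs : Summable fun k => |waveletCoeff Φ.toFun k| * C :=
    Φ.summable_waveletCoeff.abs.mul_right C
  have hle : ∀ (k : ℤ) (x : ℝ), ‖waveletCoeff Φ.toFun k * Φ.toFun (2 * x - k)‖ ≤
      |waveletCoeff Φ.toFun k| * C := by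
    intro k x
    rw [norm_mul, Real.norm_eq_abs, Real.norm_eq_abs]
    exact mul_le_mul_of_nonneg_left (hC _) (abs_nonneg _)
  refine ⟨continuous_const.mul (continuous_tsum (fun k => by fun_prop) hs hle), fun x => ?_⟩
  rw [mother, abs_mul, abs_of_nonneg (Real.sqrt_nonneg 2)]
  exact mul_le_mul_of_nonneg_left (tsum_of_norm_bounded hs.hasSum fun k => hle k x)
    (Real.sqrt_nonneg 2)

/-- Lacunary wavelet series with prescribed coefficients belong to the Hölder-Zygmund space. -/
theorem exists_bcf_beta_eq (hc : Continuous Φ.toFun) {C : ℝ} (hC : ∀ x, |Φ.toFun x| ≤ C)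
    {t δ : ℝ} (ht : 0 < t) {c : ℕ → ℝ}
    (hcδ : ∀ l, |c l| ≤ δ * (2 : ℝ) ^ (-((l : ℝ) * (t + 1 / 2)))) :
    ∃ h : ℝ →ᵇ ℝ, (∀ k, alpha Φ.toFun k h = 0) ∧
      ∀ l k, beta Φ.toFun l k h = if k = 0 then c l else 0 := by
  obtain ⟨hmc, hmb⟩ := Φ.continuous_mother hc hC
  set B := √2 * ∑' k, |waveletCoeff Φ.toFun k| * C
  have hB : 0 ≤ B := (abs_nonneg _).trans (hmb 0)
  have hwb : ∀ (l : ℕ) x, ‖waveletFun Φ.toFun l 0 x‖ ≤ (2 : ℝ) ^ ((l : ℝ) / 2) * B := by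
    intro l x
    rw [waveletFun, norm_mul, Real.norm_of_nonneg (by positivity), Real.norm_eq_abs]
    exact mul_le_mul_of_nonneg_left (hmb _) (by positivity)
  let w : ℕ → ℝ →ᵇ ℝ := fun l => BoundedContinuousFunction.ofNormedAddCommGroup
    (waveletFun Φ.toFun l 0)
    (continuous_const.mul (hmc.comp ((continuous_const.mul continuous_id).sub continuous_const)))
    _ (hwb l)
  have hwn : ∀ l, ‖w l‖ ≤ (2 : ℝ) ^ ((l : ℝ) / 2) * B := fun l =>
    BoundedContinuousFunction.norm_ofNormedAddCommGroup_le _ (by positivity) (hwb l)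
  -- The factor `2^{l/2}` from the sup norm of `ψ_{l0}` absorbs the `1/2` in the exponent of `c l`,
  -- leaving ratio `2^{-t} < 1`: the series converges uniformly.
  have hgeo : Summable fun l : ℕ => δ * B * ((2 : ℝ) ^ (-t)) ^ l :=
    (summable_geometric_of_lt_one (by positivity)
      (Real.rpow_lt_one_of_one_lt_of_neg one_lt_two (neg_lt_zero.2 ht))).mul_left _
  have hs : Summable fun l => c l • w l := by
    refine Summable.of_norm_bounded hgeo fun l => ?_
    rw [norm_smul, Real.norm_eq_abs]
    refine (mul_le_mul (hcδ l) (hwn l) (norm_nonneg _)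
      ((abs_nonneg _).trans (hcδ l))).trans (le_of_eq ?_)
    have : ((2 : ℝ) ^ (-t)) ^ l =
        (2 : ℝ) ^ (-((l : ℝ) * (t + 1 / 2))) * (2 : ℝ) ^ ((l : ℝ) / 2) := by
      rw [← Real.rpow_natCast, ← Real.rpow_mul zero_le_two, ← Real.rpow_add two_pos]
      congr 1
      ring
    rw [this]
    ring
  have hval : ∀ {g : ℝ → ℝ} (_ : Integrable g), ∫ x, g x * (∑' l, c l • w l : ℝ →ᵇ ℝ) x =
      ∑' l, c l * ∫ x, g x * waveletFun Φ.toFun l 0 x := by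
    intro g hg
    rw [← integralAgainst_apply hg, ContinuousLinearMap.map_tsum _ hs]
    refine tsum_congr fun l => ?_
    rw [map_smul, integralAgainst_apply, smul_eq_mul]
    rfl
  refine ⟨∑' l, c l • w l, fun k => ?_, fun l k => ?_⟩
  · rw [alpha, hval (Φ.integrable.comp_sub_right (k : ℝ))]
    refine (tsum_congr fun l => ?_).trans tsum_zero
    -- `φ(· - k)` is the scale-zero dilate, so it is orthogonal to every `ψ_{l0}` with `l ≥ 0`.
    have h0 := Φ.integral_dilate_mul_waveletFun (Nat.zero_le l) k 0
    simp only [dilate, Nat.cast_zero, zero_div, Real.rpow_zero, pow_zero, one_mul] at h0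
    rw [h0, mul_zero]
  · rw [beta, hval (Φ.integrable_waveletFun l k)]
    simp only [integral_waveletFun_mul]
    rw [tsum_eq_single l fun i hi => by simp [hi.symm]]
    simp

end RegularScalingFunction

theorem eHolderNorm_congr {φ p : ℝ → ℝ} (h : φ =ᵐ[volume] p) (t : ℝ) (f : ℝ → ℝ) :
    eHolderNorm φ t f = eHolderNorm p t f := by
  simp only [eHolderNorm, alpha_congr h, beta_congr h]

namespace HolderZygmund

variable {s : ℕ} {Φ : RegularScalingFunction s} {t : ℝ}

theorem abs_beta_le_norm (f : HolderZygmund Φ t) (l : ℕ) (k : ℤ) :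
    |(2 : ℝ) ^ ((l : ℝ) * (t + 1 / 2)) * beta Φ.toFun l k f.toBCF| ≤ ‖f‖ := by
  have h1 : ‖(2 : ℝ) ^ ((l : ℝ) * (t + 1 / 2)) * beta Φ.toFun l k f.toBCF‖ₑ ≤
      eHolderNorm Φ.toFun t f.toBCF :=
    (le_iSup₂ (f := fun (l : ℕ) (k : ℤ) =>
      ‖(2 : ℝ) ^ ((l : ℝ) * (t + 1 / 2)) * beta Φ.toFun l k f.toBCF‖ₑ) l k).trans
        le_add_self
  have htop : eHolderNorm Φ.toFun t f.toBCF ≠ ⊤ := ne_of_lt f.2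
  rw [norm_def]
  simpa only [toReal_enorm, Real.norm_eq_abs] using ENNReal.toReal_mono htop h1

variable (Φ t)

/-- The functions with a wavelet coefficient of maximal order at every scale. -/
def largeCoeffSet : Set (HolderZygmund Φ t) :=
  {f | ∃ ε : ℝ, 0 < ε ∧ ∀ l : ℕ, ∃ k : ℤ,
    ε ≤ |(2 : ℝ) ^ ((l : ℝ) * (t + 1 / 2)) * beta Φ.toFun l k f.toBCF|}

/-- The norm bounds all normalised coefficients uniformly in `l` and `k`, so a perturbation below `ε
/ 2` keeps the same positions `k` with threshold `ε / 2`. -/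
theorem isOpen_largeCoeffSet : IsOpen (largeCoeffSet Φ t) := by
  refine Metric.isOpen_iff.2 fun f ⟨ε, hε, hf⟩ => ⟨ε / 2, half_pos hε, fun g hg => ?_⟩
  refine ⟨ε / 2, half_pos hε, fun l => ?_⟩
  obtain ⟨k, hk⟩ := hf l
  refine ⟨k, ?_⟩
  rw [Metric.mem_ball, dist_comm, dist_eq_norm] at hg
  have h1 := abs_beta_le_norm (f - g) l k
  have h2 : beta Φ.toFun l k f.toBCF =
      beta Φ.toFun l k (f - g).toBCF + beta Φ.toFun l k g.toBCF := by
    rw [← beta_add]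
    exact congrArg (fun u : HolderZygmund Φ t => beta Φ.toFun l k u.toBCF) (sub_add_cancel f g).symm
  rw [h2, mul_add] at hk
  linarith [abs_add_le ((2 : ℝ) ^ ((l : ℝ) * (t + 1 / 2)) * beta Φ.toFun l k (f - g).toBCF)
    ((2 : ℝ) ^ ((l : ℝ) * (t + 1 / 2)) * beta Φ.toFun l k g.toBCF)]

theorem dense_largeCoeffSet (hs : 1 ≤ s) (ht : 0 < t) : Dense (largeCoeffSet Φ t) := by
  obtain ⟨Ψ, hΨ, hc, C, b, hC, hb, hbd⟩ := Φ.exists_continuous hs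
  have hbC : ∀ x, |Ψ.toFun x| ≤ C := fun x =>
    (hbd x).trans (mul_le_of_le_one_right hC.le (Real.exp_le_one_iff.2 (by
      nlinarith [abs_nonneg x])))
  refine Metric.dense_iff.2 fun f r hr => ?_
  set δ := r / 2 with hδ
  have hδ0 : 0 < δ := half_pos hr
  set P : ℕ → ℝ := fun l => (2 : ℝ) ^ ((l : ℝ) * (t + 1 / 2)) with hP
  have hP0 : ∀ l, 0 < P l := fun l => by positivity
  -- Coefficients of normalised size at least `δ / 2` are left alone; adding `δ` to a smaller one
  -- leaves more than `δ / 2`. Either way the threshold `δ / 2` is met at `k = 0`.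
  set c : ℕ → ℝ := fun l =>
    if δ / 2 ≤ |P l * beta Φ.toFun l 0 f.toBCF| then 0 else δ * (P l)⁻¹ with hcdef
  have hPc : ∀ l, |P l * c l| ≤ δ := by
    intro l
    simp only [hcdef]
    split_ifs
    · simpa using hδ0.le
    · rw [mul_left_comm, mul_inv_cancel₀ (hP0 l).ne', mul_one, abs_of_pos hδ0]
  obtain ⟨h, hα, hβ⟩ := Ψ.exists_bcf_beta_eq hc hbC ht (δ := δ) (c := c) fun l => by
    rw [Real.rpow_neg zero_le_two, ← div_eq_mul_inv, le_div_iff₀ (hP0 l), mul_comm,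
      ← abs_of_pos (hP0 l), ← abs_mul]
    exact hPc l
  have hnorm : eHolderNorm Φ.toFun t h ≤ ENNReal.ofReal δ := by
    rw [eHolderNorm_congr hΨ]
    simp only [eHolderNorm, hα, hβ, enorm_zero, iSup_const, zero_add]
    refine iSup₂_le fun l k => ?_
    rw [← ofReal_norm]
    refine ENNReal.ofReal_le_ofReal ?_
    split_ifs
    · exact hPc l
    · simpa using hδ0.le
  let g : HolderZygmund Φ t :=
    (⟨h, hnorm.trans_lt ENNReal.ofReal_lt_top⟩ : holderZygmundSubmodule Φ t)
  have hg : g.toBCF = h := rfl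
  have hgn : ‖g‖ ≤ δ := by
    rw [norm_def, hg]
    exact ENNReal.toReal_le_of_le_ofReal hδ0.le hnorm
  refine ⟨f + g, ?_, δ / 2, half_pos hδ0, fun l => ⟨0, ?_⟩⟩
  · rw [Metric.mem_ball, dist_eq_norm, add_sub_cancel_left]
    linarith
  · have h1 : beta Φ.toFun l 0 (f + g).toBCF = beta Φ.toFun l 0 f.toBCF + c l := by
      have : (f + g).toBCF = f.toBCF + h := rfl
      rw [this, beta_add, beta_congr hΨ l 0 h, hβ, if_pos rfl]
    rw [h1, mul_add]
    change δ / 2 ≤ |P l * _ + P l * c l|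
    simp only [hcdef]
    split_ifs with h2
    · simpa using h2
    · rw [mul_left_comm (P l) δ, mul_inv_cancel₀ (hP0 l).ne', mul_one]
      have h3 := neg_abs_le (P l * beta Φ.toFun l 0 f.toBCF)
      exact le_trans (by linarith) (le_abs_self _)

theorem largeCoeffSet_subset (hs : 1 ≤ s) : largeCoeffSet Φ t ⊆ (exceptionalSet Φ t)ᶜ := by
  obtain ⟨Ψ, hΨ, hc, C, b, hC, hb, hbd⟩ := Φ.exists_continuous hs
  obtain ⟨M, hM⟩ := exists_tsum_translates_bound hC hb hbd
  rintro f ⟨ε, hε, hf⟩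
  have hI0 : 0 ≤ ∫ x, |mother Ψ.toFun x| := integral_nonneg fun x => abs_nonneg _
  -- Every scale has a large coefficient, so `j₀ = 0` works; the rate comes from `2^{j/2} =
  -- 2^{j(t+1/2)} 2^{-jt}`.
  refine not_not.2 ⟨((∫ x, |mother Ψ.toFun x|) + 1)⁻¹ * ε, by positivity, 0, fun j _ => ?_⟩
  obtain ⟨k, hk⟩ := hf j
  refine le_trans (ENNReal.ofReal_le_ofReal ?_) (Ψ.abs_beta_le_eSupNorm hM hΨ j k f.toBCF)
  rw [mul_assoc]
  refine mul_le_mul_of_nonneg_left ?_ (by positivity)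
  rw [abs_mul, abs_of_pos (by positivity), beta_congr hΨ] at hk
  have h1 : (2 : ℝ) ^ ((j : ℝ) * (t + 1 / 2)) * (2 : ℝ) ^ (-((j : ℝ) * t)) =
      (2 : ℝ) ^ ((j : ℝ) / 2) := by
    rw [← Real.rpow_add two_pos]
    congr 1
    ring
  rw [← h1, mul_right_comm]
  exact mul_le_mul_of_nonneg_right hk (by positivity)

end HolderZygmund

end Wavelet

end

theorem proposition4 (r : ℕ) (t : ℝ) (ht : 0 < t) (htr : t < (r : ℝ) - 1)
    (Φ : Wavelet.RegularScalingFunction (r - 1)) :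
    IsNowhereDense (Wavelet.exceptionalSet Φ t) := by
  -- `0 < t < r - 1` forces `r ≥ 2`, so the natural subtraction `r - 1` is not truncated and at
  -- least one weak derivative is available.
  have hr : 1 < r := by
    have : (1 : ℝ) < r := by linarith
    exact_mod_cast this
  have hs : 1 ≤ r - 1 := by omega
  have hsub : closure (Wavelet.exceptionalSet Φ t) ⊆
      (Wavelet.HolderZygmund.largeCoeffSet Φ t)ᶜ :=
    closure_minimal (Set.subset_compl_comm.1 (Wavelet.HolderZygmund.largeCoeffSet_subset Φ t hs))
      (Wavelet.HolderZygmund.isOpen_largeCoeffSet Φ t).isClosed_compl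
  refine Set.subset_eq_empty (interior_mono hsub) ?_
  rw [interior_compl, (Wavelet.HolderZygmund.dense_largeCoeffSet Φ t hs ht).closure_eq,
    Set.compl_univ]
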